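/- Let $\mathbb X$ be a Banach space over $\mathbb F=\mathbb R$ or $\mathbb C$ with a semi-normalized Markushevich basis $\mathcal B=(\mathbf e_i)_{i=1}^\infty$ and biorthogonal functionals $(\mathbf e_i^*)_{i=1}^\infty\subset\mathbb X^*$. That is, the closed linear span of $\{\mathbf e_i : i\in\mathbb N\}$ is $\mathbb X$; $\mathbf e_k^*(\mathbf e_i)=\delta_{k,i}$ for all $k,i$; if $\mathbf e_i^*(x)=0$ for all $i$ then $x=0$; and $\sup_i\max\{\|\mathbf e_i\|,\|\mathbf e_i^*\|\}<\infty$. A finite set $A\subset\mathbb N$ is a greedy set for $x\in\mathbb X$ if $|\mathbf e_i^*(x)|\ge|\mathbf e_j^*(x)|$ for all $i\in A$ and $j\notin A$. For a strictly increasing sequence $\mathbf n=(n_k)_{k}$ of positive integers, $\mathcal B$ is called $\mathbf n$-quasi-greedy if there is a constant $C>0$ such that $$\Big\|\sum_{i\in A}\mathbf e_i^*(x)\,\mathbf e_i\Big\|\le C\|x\|$$ for every $x\in\mathbb X$ and every greedy set $A$ for $x$ whose cardinality is one of the $n_k$. It is called quasi-greedy if this holds with $n_k=k$, that is, for greedy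 sets of every cardinality $m\ge 1$. Suppose that, for some strictly increasing sequence $\mathbf n$ of positive integers, $\mathcal B$ is $\mathbf n$-quasi-greedy, and that $\mathcal B$ is weakly null, i.e. $\lim_{i\to\infty}x^*(\mathbf e_i)=0$ for every $x^*\in\mathbb X^*$. Then $\mathcal B$ has a quasi-greedy subsequence: there are $i_1<i_2<\cdots$ such that $(\mathbf e_{i_k})_{k=1}^\infty$ is a semi-normalized Markushevich basis of its closed linear span and is quasi-greedy there (with respect to its biorthogonal functionals on that span). -/

import Mathlib

open Filter Topology

noncomputable section

/-- `e` is a semi-normalized Markushevich basis of the normed space `X` with biorthogonal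
functionals `f`. -/
structure IsSeminormalizedMBasis (𝕜 : Type*) [RCLike 𝕜] {X : Type*} [NormedAddCommGroup X]
    [NormedSpace 𝕜 X] (e : ℕ → X) (f : ℕ → StrongDual 𝕜 X) : Prop where
  /-- the linear span of the basis vectors is dense -/
  dense_span : (Submodule.span 𝕜 (Set.range e)).topologicalClosure = ⊤
  biorthogonal : ∀ k i, f k (e i) = if k = i then 1 else 0
  /-- the functionals separate the points -/
  total : ∀ x, (∀ i, f i x = 0) → x = 0
  bounded : ∃ c : ℝ, 0 < c ∧ ∀ i, ‖e i‖ ≤ c ∧ ‖f i‖ ≤ c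

/-- The finite set `A` is a greedy set for `x`: no coefficient of `x` outside `A` exceeds, in
modulus, a coefficient with index in `A`. -/
def IsGreedySet {𝕜 : Type*} [RCLike 𝕜] {X : Type*} [NormedAddCommGroup X] [NormedSpace 𝕜 X]
    (f : ℕ → StrongDual 𝕜 X) (x : X) (A : Finset ℕ) : Prop :=
  ∀ i ∈ A, ∀ j ∉ A, ‖f j x‖ ≤ ‖f i x‖

/-- The coordinate projection `P_A x = ∑ i ∈ A, f i x • e i`. If `A` is a greedy set for `x`,
this is a greedy sum of `x` of order `A.card`. -/
def coordProj {𝕜 : Type*} [RCLike 𝕜] {X : Type*} [NormedAddCommGroup X] [NormedSpace 𝕜 X]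
    (e : ℕ → X) (f : ℕ → StrongDual 𝕜 X) (A : Finset ℕ) (x : X) : X :=
  ∑ i ∈ A, f i x • e i

/-- The greedy sums whose order belongs to `N` are uniformly bounded. -/
def IsQuasiGreedyFor {𝕜 : Type*} [RCLike 𝕜] {X : Type*} [NormedAddCommGroup X]
    [NormedSpace 𝕜 X] (N : Set ℕ) (e : ℕ → X) (f : ℕ → StrongDual 𝕜 X) : Prop :=
  ∃ C : ℝ, 0 < C ∧ ∀ (x : X) (A : Finset ℕ), A.card ∈ N → IsGreedySet f x A →
    ‖coordProj e f A x‖ ≤ C * ‖x‖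

/-- Quasi-greedy: the greedy sums of all orders `m ≥ 1` are uniformly bounded. -/
def IsQuasiGreedy {𝕜 : Type*} [RCLike 𝕜] {X : Type*} [NormedAddCommGroup X]
    [NormedSpace 𝕜 X] (e : ℕ → X) (f : ℕ → StrongDual 𝕜 X) : Prop :=
  IsQuasiGreedyFor {m : ℕ | 1 ≤ m} e f

/-- `e` converges weakly to `0`. -/
def IsWeaklyNull (𝕜 : Type*) [RCLike 𝕜] {X : Type*} [NormedAddCommGroup X] [NormedSpace 𝕜 X]
    (e : ℕ → X) : Prop :=
  ∀ φ : StrongDual 𝕜 X, Tendsto (fun i => φ (e i)) atTop (𝓝 0)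

/-- The closed linear span of a sequence. -/
def closedSpan (𝕜 : Type*) [RCLike 𝕜] {X : Type*} [NormedAddCommGroup X] [NormedSpace 𝕜 X]
    (u : ℕ → X) : Submodule 𝕜 X :=
  (Submodule.span 𝕜 (Set.range u)).topologicalClosure

theorem mem_closedSpan (𝕜 : Type*) [RCLike 𝕜] {X : Type*} [NormedAddCommGroup X]
    [NormedSpace 𝕜 X] (u : ℕ → X) (k : ℕ) : u k ∈ closedSpan 𝕜 u :=
  Submodule.le_topologicalClosure _ (Submodule.subset_span (Set.mem_range_self k))

/-- The sequence `u`, regarded as a sequence in its closed linear span. -/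
def toClosedSpan (𝕜 : Type*) [RCLike 𝕜] {X : Type*} [NormedAddCommGroup X] [NormedSpace 𝕜 X]
    (u : ℕ → X) (k : ℕ) : closedSpan 𝕜 u :=
  ⟨u k, mem_closedSpan 𝕜 u k⟩

/-- The sequence `u` is quasi-greedy: it is a semi-normalized Markushevich basis of its closed
linear span, and, with respect to its (unique) biorthogonal functionals on that span, it is
quasi-greedy. -/
def IsQuasiGreedySequence (𝕜 : Type*) [RCLike 𝕜] {X : Type*} [NormedAddCommGroup X]
    [NormedSpace 𝕜 X] (u : ℕ → X) : Prop :=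
  ∃ g : ℕ → StrongDual 𝕜 (closedSpan 𝕜 u),
    IsSeminormalizedMBasis 𝕜 (toClosedSpan 𝕜 u) g ∧ IsQuasiGreedy (toClosedSpan 𝕜 u) g

end

/-! Ask whether the even-indexed half of the basis carries arbitrarily long vectors with
coefficients of modulus at least one and bounded norm.

If it does, the odd-indexed half is quasi-greedy (`isQuasiGreedySequence_of_padding`). For `x` in
its span and a greedy set `A` with least modulus `t`, adding `t` times such a vector completes `A`
to a greedy set of an admissible order, at a cost of order `t`, hence of order `‖x‖`.

If it does not, a suitable length `N s` forces norms above `2 * K * (s + 1)`. Weak nullity yields a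
subsequence of the even half on which projections onto `[0, s) ∪ B`, with `B` beyond `s` and `B.card
≤ h s`, are bounded by a `K` independent of `h` (`exists_subseq_norm_coordProj_le`); so `h` may be
chosen after `N`. With `s` about `‖x‖ / t`, the part `B` of `A` beyond `s` is then small enough to
be projected on, and the coefficients below `s` outside `A` contribute at most `s * t * c ≤ c * ‖x‖`
(`norm_coordProj_le_of_isGreedySet`). -/

noncomputable section

/-! ### Iterated ultrafilter limits of norms -/

/-- The iterated ultrafilter limit of `‖y + a₁ v_{l₁} + ⋯ + aₙ v_{lₙ}‖` as `lₙ`, then `lₙ₋₁`, …,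
then `l₁` tend to infinity, where the list is `[a₁, …, aₙ]`. -/
def iteratedLimitNorm {𝕜 X : Type*} [RCLike 𝕜] [NormedAddCommGroup X] [NormedSpace 𝕜 X]
    (v : ℕ → X) : List 𝕜 → X → ℝ
  | [], y => ‖y‖
  | a :: as, y => limUnder (hyperfilter ℕ : Filter ℕ) fun l => iteratedLimitNorm v as (y + a • v l)

namespace iteratedLimitNorm

variable {𝕜 X : Type*} [RCLike 𝕜] [NormedAddCommGroup X] [NormedSpace 𝕜 X] {v : ℕ → X} {c : ℝ}

@[simp] theorem nil (y : X) : iteratedLimitNorm v ([] : List 𝕜) y = ‖y‖ := rfl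

theorem exists_tendsto_of_mem_Icc {α : Type*} (U : Ultrafilter α) {g : α → ℝ} {a b : ℝ}
    (h : ∀ x, g x ∈ Set.Icc a b) : ∃ r ∈ Set.Icc a b, Tendsto g U (𝓝 r) := by
  obtain ⟨r, hr, hr'⟩ := isCompact_Icc.ultrafilter_le_nhds (U.map g)
    (le_principal_iff.2 (Filter.mem_map.2 (univ_mem' h)))
  exact ⟨r, hr, hr'⟩

/-- These bounds place the values in a compact interval, so every `limUnder` in the definition is a
genuine limit. -/
theorem mem_Icc (hv : ∀ i, ‖v i‖ ≤ c) (as : List 𝕜) (y : X) :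
    iteratedLimitNorm v as y ∈ Set.Icc 0 (‖y‖ + c * (as.map norm).sum) := by
  induction as generalizing y with
  | nil => simp
  | cons a as ih =>
    have h : ∀ l, iteratedLimitNorm v as (y + a • v l) ∈
        Set.Icc 0 (‖y‖ + c * ((a :: as).map norm).sum) := by
      intro l
      refine ⟨(ih _).1, (ih _).2.trans ?_⟩
      have h1 : ‖y + a • v l‖ ≤ ‖y‖ + ‖a‖ * c :=
        (norm_add_le _ _).trans (by rw [norm_smul]; gcongr; exact hv l)
      simp only [List.map_cons, List.sum_cons]
      linarith
    obtain ⟨r, hr, hr'⟩ := exists_tendsto_of_mem_Icc (hyperfilter ℕ) h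
    have : iteratedLimitNorm v (a :: as) y = r := hr'.limUnder_eq
    rwa [this]

theorem tendsto (hv : ∀ i, ‖v i‖ ≤ c) (a : 𝕜) (as : List 𝕜) (y : X) :
    Tendsto (fun l => iteratedLimitNorm v as (y + a • v l)) (hyperfilter ℕ : Filter ℕ)
      (𝓝 (iteratedLimitNorm v (a :: as) y)) := by
  refine tendsto_nhds_limUnder ?_
  obtain ⟨r, -, hr⟩ := exists_tendsto_of_mem_Icc (hyperfilter ℕ)
    (g := fun l => iteratedLimitNorm v as (y + a • v l)) (a := 0)
    (b := ‖y‖ + ‖a‖ * c + c * (as.map norm).sum) (fun l => by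
      refine ⟨(mem_Icc hv as _).1, (mem_Icc hv as _).2.trans ?_⟩
      have h1 : ‖y + a • v l‖ ≤ ‖y‖ + ‖a‖ * c :=
        (norm_add_le _ _).trans (by rw [norm_smul]; gcongr; exact hv l)
      linarith)
  exact ⟨r, hr⟩

theorem le_add_norm_sub (hv : ∀ i, ‖v i‖ ≤ c) (as : List 𝕜) (y z : X) :
    iteratedLimitNorm v as y ≤ iteratedLimitNorm v as z + ‖y - z‖ := by
  induction as generalizing y z with
  | nil => simpa using norm_le_norm_add_norm_sub' y z
  | cons a as ih =>
    refine le_of_tendsto_of_tendsto' (tendsto hv a as y) ((tendsto hv a as z).add_const _) ?_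
    intro l
    simpa using ih (y + a • v l) (z + a • v l)

theorem continuous (hv : ∀ i, ‖v i‖ ≤ c) (as : List 𝕜) :
    Continuous (iteratedLimitNorm v as) := by
  refine (LipschitzWith.of_le_add_mul 1 fun y z => ?_).continuous
  simpa [dist_eq_norm] using le_add_norm_sub hv as y z

theorem convexOn [NormedSpace ℝ X] [IsScalarTower ℝ 𝕜 X] (hv : ∀ i, ‖v i‖ ≤ c)
    (as : List 𝕜) : ConvexOn ℝ Set.univ (iteratedLimitNorm v as) := by
  induction as with
  | nil => exact convexOn_univ_norm
  | cons a as ih =>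
    refine ⟨convex_univ, fun y _ z _ r s hr hs hrs => ?_⟩
    refine le_of_tendsto_of_tendsto' (tendsto hv a as _)
      (((tendsto hv a as y).const_smul r).add ((tendsto hv a as z).const_smul s)) fun l => ?_
    have : r • y + s • z + a • v l = r • (y + a • v l) + s • (z + a • v l) := by
      calc r • y + s • z + a • v l = r • y + s • z + (r + s) • a • v l := by rw [hrs, one_smul]
        _ = _ := by module
    rw [this]
    exact ih.2 trivial trivial hr hs hrs

/-- A continuous convex function is weakly lower semicontinuous, and `y + b • v l` tends weakly to
`y`: a functional separating `y` from the closed convex sublevel set would contradict this. -/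
theorem eventually_sub_le (hv : ∀ i, ‖v i‖ ≤ c) (hw : IsWeaklyNull 𝕜 v) (as : List 𝕜) (y : X)
    (b : 𝕜) {ε : ℝ} (hε : 0 < ε) :
    ∀ᶠ l in (hyperfilter ℕ : Filter ℕ),
      iteratedLimitNorm v as y - ε ≤ iteratedLimitNorm v as (y + b • v l) := by
  let : NormedSpace ℝ X := NormedSpace.restrictScalars ℝ 𝕜 X
  have : IsScalarTower ℝ 𝕜 X := RestrictScalars.isScalarTower ℝ 𝕜 X
  by_contra hcon
  rw [Ultrafilter.eventually_not.symm] at hcon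
  set Z : Set X := {z | z ∈ Set.univ ∧ iteratedLimitNorm v as z ≤ iteratedLimitNorm v as y - ε}
  have hZc : Convex ℝ Z := (convexOn hv as).convex_le _
  have hZ : IsClosed Z := by
    have : Z = {z | iteratedLimitNorm v as z ≤ iteratedLimitNorm v as y - ε} := by
      ext; simp [Z]
    rw [this]
    exact isClosed_le (continuous hv as) continuous_const
  have hy : y ∉ Z := by
    rintro ⟨-, h⟩
    linarith
  obtain ⟨φ, u, hu, hφ⟩ := RCLike.geometric_hahn_banach_point_closed (𝕜 := 𝕜) hZc hZ hy
  have hlim : Tendsto (fun l => RCLike.re (φ (y + b • v l))) (hyperfilter ℕ : Filter ℕ)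
      (𝓝 (RCLike.re (φ y))) := by
    have h0 : Tendsto (fun l => φ (v l)) (hyperfilter ℕ : Filter ℕ) (𝓝 0) :=
      (hw φ).mono_left (Nat.cofinite_eq_atTop ▸ hyperfilter_le_cofinite)
    have h1 := (RCLike.continuous_re.tendsto _).comp ((h0.const_mul b).const_add (φ y))
    simpa [Function.comp_def] using h1
  refine absurd (ge_of_tendsto hlim ?_) (not_le.2 hu)
  filter_upwards [hcon] with l hl
  exact (hφ _ ⟨trivial, (not_le.1 hl).le⟩).le

end iteratedLimitNorm

end

/-! ### Selection of the subsequence for finitely many coefficients -/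

noncomputable section

/-- Inductive selection: at each stage, the admissible indices depend on the current state, and the
state is updated after an index has been selected. -/
theorem exists_strictMono_of_eventually {α : Type*} {U : Filter ℕ} [U.NeBot] (hU : U ≤ atTop)
    (a₀ : α) (step : ℕ → α → ℕ → α) (P : ℕ → α → ℕ → Prop)
    (h : ∀ q a, ∀ᶠ l in U, P q a l) :
    ∃ (l : ℕ → ℕ) (a : ℕ → α), StrictMono l ∧ a 0 = a₀ ∧
      (∀ q, a (q + 1) = step q (a q) (l q)) ∧ ∀ q, P q (a q) (l q) := by
  have h' : ∀ q a m, ∃ l, P q a l ∧ m < l := fun q a m =>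
    ((h q a).and (hU (eventually_gt_atTop m))).exists
  choose g hg hlt using h'
  let st : ℕ → α × ℕ := fun q => Nat.rec (a₀, 0)
    (fun q s => (step q s.1 (g q s.1 s.2), g q s.1 s.2)) q
  refine ⟨fun q => g q (st q).1 (st q).2, fun q => (st q).1, strictMono_nat_of_lt_succ fun q => ?_,
    rfl, fun q => rfl, fun q => hg _ _ _⟩
  exact hlt (q + 1) (st (q + 1)).1 (st (q + 1)).2

theorem Set.Finite.finite_list_length_le {α : Type*} {s : Set α} (hs : s.Finite) (n : ℕ) :
    {l : List α | l.length ≤ n ∧ ∀ a ∈ l, a ∈ s}.Finite := by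
  have := hs.to_subtype
  refine ((List.finite_length_le s n).image (List.map Subtype.val)).subset ?_
  rintro l ⟨hl, hls⟩
  refine ⟨l.attach.map fun a => ⟨a.1, hls a.1 a.2⟩, by simpa using hl, ?_⟩
  simp [Function.comp_def]

variable {𝕜 X : Type*} [RCLike 𝕜] [NormedAddCommGroup X] [NormedSpace 𝕜 X] {v : ℕ → X} {c : ℝ}

/-- A weakly null sequence has a subsequence along which the iterated limits of the norm, with
coefficients in given finite sets, are attained and not diminished up to prescribed errors. -/
theorem exists_subseq_iteratedLimitNorm (hv : ∀ i, ‖v i‖ ≤ c) (hw : IsWeaklyNull 𝕜 v)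
    (Λ : ℕ → Finset 𝕜) (h : ℕ → ℕ) (ε : ℕ → ℝ) (hε : ∀ q, 0 < ε q) :
    ∃ l : ℕ → ℕ, StrictMono l ∧ ∀ q, ∀ ξ : ℕ → 𝕜, (∀ i < q, ξ i ∈ Λ i) →
      ∀ as : List 𝕜, as.length ≤ h q → (∀ a ∈ as, a ∈ Λ q) →
      (∀ b ∈ Λ q, iteratedLimitNorm v as (∑ i ∈ Finset.range q, ξ i • v (l i)) - ε q ≤
        iteratedLimitNorm v as (∑ i ∈ Finset.range q, ξ i • v (l i) + b • v (l q))) ∧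
      ∀ a ∈ Λ q, iteratedLimitNorm v as (∑ i ∈ Finset.range q, ξ i • v (l i) + a • v (l q)) ≤
        iteratedLimitNorm v (a :: as) (∑ i ∈ Finset.range q, ξ i • v (l i)) + ε q ∧
        iteratedLimitNorm v (a :: as) (∑ i ∈ Finset.range q, ξ i • v (l i)) - ε q ≤
        iteratedLimitNorm v as (∑ i ∈ Finset.range q, ξ i • v (l i) + a • v (l q)) := by
  classical
  have hU : (hyperfilter ℕ : Filter ℕ) ≤ atTop := Nat.cofinite_eq_atTop ▸ hyperfilter_le_cofinite
  let L : ℕ → Set (List 𝕜) := fun q => {l | l.length ≤ h q ∧ ∀ a ∈ l, a ∈ (Λ q : Set 𝕜)}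
  obtain ⟨l, Y, hl, hY0, hY, hP⟩ := exists_strictMono_of_eventually hU ({0} : Finset X)
    -- The state is the finite set of all sums built so far; with finitely many lists and scalars,
    -- each stage imposes finitely many eventual conditions.
    (fun q Y l => Finset.image₂ (fun y b => y + b • v l) Y (Λ q))
    (fun q Y l => ∀ y ∈ Y, ∀ as ∈ L q, ∀ a ∈ Λ q,
      iteratedLimitNorm v as y - ε q ≤ iteratedLimitNorm v as (y + a • v l) ∧
      iteratedLimitNorm v as (y + a • v l) ≤ iteratedLimitNorm v (a :: as) y + ε q ∧
      iteratedLimitNorm v (a :: as) y - ε q ≤ iteratedLimitNorm v as (y + a • v l))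
    (fun q Y => by
      rw [eventually_all_finset]
      intro y _
      rw [eventually_all_finite ((Λ q).finite_toSet.finite_list_length_le (h q))]
      intro as _
      rw [eventually_all_finset]
      intro a _
      have ht := iteratedLimitNorm.tendsto hv a as y
      refine (iteratedLimitNorm.eventually_sub_le hv hw as y a (hε q)).and ?_
      filter_upwards [ht.eventually_le_const (lt_add_of_pos_right _ (hε q)),
        ht.eventually_const_le (sub_lt_self _ (hε q))] with l h1 h2
      exact ⟨h1, h2⟩)
  have hmem : ∀ q, ∀ ξ : ℕ → 𝕜, (∀ i < q, ξ i ∈ Λ i) →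
      ∑ i ∈ Finset.range q, ξ i • v (l i) ∈ Y q := by
    intro q ξ hξ
    induction q with
    | zero => simp [hY0]
    | succ q ih =>
      rw [Finset.sum_range_succ, hY]
      exact Finset.mem_image₂_of_mem (ih fun i hi => hξ i (by omega)) (hξ q (by omega))
  exact ⟨l, hl, fun q ξ hξ as has hasΛ =>
    ⟨fun b hb => (hP q _ (hmem q ξ hξ) as ⟨has, hasΛ⟩ b hb).1,
      fun a ha => (hP q _ (hmem q ξ hξ) as ⟨has, hasΛ⟩ a ha).2⟩⟩

/-- Along such a subsequence, the projection onto an initial segment and few further indices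
almost does not increase the norm of a vector with coefficients in the given finite sets. -/
theorem exists_subseq_norm_sum_filter_le (hv : ∀ i, ‖v i‖ ≤ c) (hw : IsWeaklyNull 𝕜 v)
    (Λ : ℕ → Finset 𝕜) (hΛ : Monotone Λ) (hΛ0 : ∀ q, 0 ∈ Λ q) (h : ℕ → ℕ) (hh : Monotone h)
    (ε : ℕ → ℝ) (hε : ∀ q, 0 < ε q) :
    ∃ l : ℕ → ℕ, StrictMono l ∧ ∀ (s : ℕ) (A : Finset ℕ) (ξ : ℕ → 𝕜) (Q : ℕ), s ≤ Q →
      A.card ≤ h s → (∀ i ∈ A, ξ i ∈ Λ s) → (∀ i, ξ i ∈ Λ i) →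
      ‖∑ i ∈ Finset.range Q with i < s ∨ i ∈ A, ξ i • v (l i)‖ ≤
        ‖∑ i ∈ Finset.range Q, ξ i • v (l i)‖ + 2 * ∑ i ∈ Finset.range Q, ε i := by
  classical
  obtain ⟨l, hl, H⟩ := exists_subseq_iteratedLimitNorm hv hw Λ h ε hε
  refine ⟨l, hl, fun s A ξ Q hsQ hA hAΛ hξ => ?_⟩
  -- The coefficients on `A` with index in `[j, Q)`, still represented by iterated limits at stage
  -- `j`.
  set T : ℕ → List 𝕜 := fun j => ((List.range' j (Q - j)).filter (· ∈ A)).map ξ with hT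
  have hTΛ : ∀ j, s ≤ j → ∀ a ∈ T j, a ∈ Λ j := by
    intro j hj a ha
    simp only [hT, List.mem_map, List.mem_filter, decide_eq_true_eq] at ha
    obtain ⟨i, ⟨-, hi⟩, rfl⟩ := ha
    exact hΛ hj (hAΛ i hi)
  have hTlen : ∀ j, s ≤ j → (T j).length ≤ h j := by
    intro j hj
    refine le_trans ?_ (hA.trans (hh hj))
    have hnd : ((List.range' j (Q - j)).filter (· ∈ A)).Nodup :=
      List.Nodup.filter _ List.nodup_range'
    rw [hT, List.length_map, ← List.toFinset_card_of_nodup hnd]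
    exact Finset.card_le_card fun i hi => by simp at hi; exact hi.2
  have hTsucc : ∀ j < Q, T j = if j ∈ A then ξ j :: T (j + 1) else T (j + 1) := by
    intro j hj
    have : Q - j = (Q - (j + 1)) + 1 := by omega
    simp only [hT]
    rw [this, List.range'_succ]
    split_ifs with hjA <;> simp [hjA]
  have hTQ : T Q = [] := by simp [hT]
  let ζ : ℕ → 𝕜 := fun i => if i < s ∨ i ∈ A then ξ i else 0
  have hζ : ∀ i, ζ i ∈ Λ i := by
    intro i
    simp only [ζ]
    split_ifs
    exacts [hξ i, hΛ0 i]
  let y : ℕ → X := fun j => ∑ i ∈ Finset.range j, ξ i • v (l i)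
  let z : ℕ → X := fun j => ∑ i ∈ Finset.range j, ζ i • v (l i)
  have hy : ∀ j, y (j + 1) = y j + ξ j • v (l j) := fun j => Finset.sum_range_succ _ _
  have hz : ∀ j, z (j + 1) = z j + ζ j • v (l j) := fun j => Finset.sum_range_succ _ _
  have hys : z s = y s := Finset.sum_congr rfl fun i hi => by
    simp [ζ, Finset.mem_range.1 hi]
  -- Indices in `A` replace a limit by an actual term; the others add a term, which by weak nullity
  -- hardly lowers the value.
  have h1 : ∀ j, s ≤ j → j ≤ Q → iteratedLimitNorm v (T s) (y s) ≤
      iteratedLimitNorm v (T j) (y j) + ∑ i ∈ Finset.range j, ε i := by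
    intro j hj
    induction j, hj using Nat.le_induction with
    | base => intro _; simpa using Finset.sum_nonneg fun i _ => (hε i).le
    | succ j hj ih =>
      intro hjQ
      refine (ih (by omega)).trans ?_
      have h2 := H j ξ (fun i _ => hξ i) (T (j + 1))
      rw [Finset.sum_range_succ, hy, hTsucc j hjQ]
      split_ifs with hjA
      · have hT' := hTlen j hj
        have hT2 := hTΛ j hj
        rw [hTsucc j hjQ, if_pos hjA] at hT' hT2
        have := ((h2 (by simp at hT'; omega) (fun a ha => hT2 a (by simp [ha]))).2 (ξ j) (hξ j)).2
        change _ ≤ iteratedLimitNorm v _ (y j + _) at this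
        change iteratedLimitNorm v _ (y j) - _ ≤ _ at this
        linarith
      · have hT' := hTlen j hj
        have hT2 := hTΛ j hj
        rw [hTsucc j hjQ, if_neg hjA] at hT' hT2
        have := (h2 hT' hT2).1 (ξ j) (hξ j)
        change iteratedLimitNorm v _ (y j) - _ ≤ iteratedLimitNorm v _ (y j + _) at this
        linarith
  -- The reverse estimate for the truncated sum, where indices outside `A` add nothing. Both chains
  -- start at the same value, since `z s = y s`.
  have h2 : ∀ j, s ≤ j → j ≤ Q → iteratedLimitNorm v (T j) (z j) ≤
      iteratedLimitNorm v (T s) (z s) + ∑ i ∈ Finset.range j, ε i := by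
    intro j hj
    induction j, hj using Nat.le_induction with
    | base => intro _; simpa using Finset.sum_nonneg fun i _ => (hε i).le
    | succ j hj ih =>
      intro hjQ
      have ih := ih (by omega)
      rw [Finset.sum_range_succ, hz]
      rw [hTsucc j hjQ] at ih
      split_ifs at ih with hjA
      · have hT' := hTlen j hj
        have hT2 := hTΛ j hj
        rw [hTsucc j hjQ, if_pos hjA] at hT' hT2
        have := ((H j ζ (fun i _ => hζ i) (T (j + 1)) (by simp at hT'; omega)
          (fun a ha => hT2 a (by simp [ha]))).2 (ξ j) (hξ j)).1
        change iteratedLimitNorm v _ (z j + _) ≤ iteratedLimitNorm v _ (z j) + _ at this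
        have hζj : ζ j = ξ j := by simp [ζ, hjA]
        rw [hζj]
        linarith
      · have hζj : ζ j = 0 := by simp [ζ, hjA, hj]
        rw [hζj, zero_smul, add_zero]
        linarith [hε j]
  have h3 := h1 Q hsQ le_rfl
  have h4 := h2 Q hsQ le_rfl
  rw [hTQ, iteratedLimitNorm.nil] at h3 h4
  rw [hys] at h4
  have hzQ : z Q = ∑ i ∈ Finset.range Q with i < s ∨ i ∈ A, ξ i • v (l i) := by
    rw [Finset.sum_filter]
    exact Finset.sum_congr rfl fun i _ => by simp only [ζ]; split_ifs <;> simp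
  rw [← hzQ]
  change ‖z Q‖ ≤ ‖y Q‖ + _
  linarith

end

/-! ### Discretization and bounded Schreier-type projections -/

noncomputable section

theorem exists_monotone_finite_nets (𝕜 : Type*) [RCLike 𝕜] (R : ℝ) (δ : ℕ → ℝ)
    (hδ : ∀ q, 0 < δ q) :
    ∃ Λ : ℕ → Finset 𝕜, Monotone Λ ∧ (∀ q, 0 ∈ Λ q) ∧
      ∀ q, ∀ z : 𝕜, ‖z‖ ≤ R → ∃ w ∈ Λ q, ‖z - w‖ ≤ δ q := by
  classical
  have hnet : ∀ q, ∃ t : Finset 𝕜, ∀ z : 𝕜, ‖z‖ ≤ R → ∃ w ∈ t, ‖z - w‖ ≤ δ q := by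
    intro q
    obtain ⟨t, -, ht, hcov⟩ := (isCompact_closedBall (0 : 𝕜) R).finite_cover_balls (hδ q)
    refine ⟨ht.toFinset, fun z hz => ?_⟩
    obtain ⟨w, hw, hzw⟩ := Set.mem_iUnion₂.1 (hcov (mem_closedBall_zero_iff.2 hz))
    exact ⟨w, by simpa using hw, by simpa [dist_eq_norm] using (Metric.mem_ball.1 hzw).le⟩
  choose t ht using hnet
  refine ⟨fun q => insert 0 ((Finset.range (q + 1)).biUnion t), fun p q hpq => ?_,
    fun q => Finset.mem_insert_self _ _, fun q z hz => ?_⟩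
  · exact Finset.insert_subset_insert _ (Finset.biUnion_subset_biUnion_of_subset_left _
      (Finset.range_mono (by omega)))
  · obtain ⟨w, hw, hzw⟩ := ht q z hz
    exact ⟨w, Finset.mem_insert_of_mem (Finset.mem_biUnion.2 ⟨q, by simp, hw⟩), hzw⟩

variable {𝕜 X : Type*} [RCLike 𝕜] [NormedAddCommGroup X] [NormedSpace 𝕜 X] {v : ℕ → X} {c : ℝ}

/-- A bounded weakly null sequence has a Schreier-type unconditional subsequence: the projections
onto `[0, s) ∪ A` with `A` beyond `s` and `A.card ≤ h s` are controlled on vectors with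
bounded coefficients. -/
theorem exists_subseq_norm_sum_filter_le_of_norm_le (hv : ∀ i, ‖v i‖ ≤ c)
    (hw : IsWeaklyNull 𝕜 v) (h : ℕ → ℕ) (hh : Monotone h) (R : ℝ) :
    ∃ l : ℕ → ℕ, StrictMono l ∧ ∀ (s : ℕ) (A : Finset ℕ) (ξ : ℕ → 𝕜) (Q : ℕ), s ≤ Q →
      A.card ≤ h s → (∀ i ∈ A, s ≤ i) → (∀ i, ‖ξ i‖ ≤ R) →
      ‖∑ i ∈ Finset.range Q with i < s ∨ i ∈ A, ξ i • v (l i)‖ ≤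
        ‖∑ i ∈ Finset.range Q, ξ i • v (l i)‖ + (6 * c + 4) := by
  classical
  have hc : 0 ≤ c := (norm_nonneg _).trans (hv 0)
  let ε : ℕ → ℝ := fun q => (1 / 2) ^ q
  have hε : ∀ q, 0 < ε q := fun q => by positivity
  have hεsum : ∀ Q, ∑ i ∈ Finset.range Q, ε i ≤ 2 := sum_geometric_two_le
  -- The first bound sums to at most 2 over all indices; the second, at stage `s`, to at most 1 over
  -- the at most `h s` indices of `A`.
  let δ : ℕ → ℝ := fun q => min (ε q) (1 / (1 + h q))
  obtain ⟨Λ, hΛ, hΛ0, hnet⟩ := exists_monotone_finite_nets 𝕜 R δ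
    (fun q => lt_min (hε q) (by positivity))
  obtain ⟨l, hl, H⟩ := exists_subseq_norm_sum_filter_le hv hw Λ hΛ hΛ0 h hh ε hε
  refine ⟨l, hl, fun s A ξ Q hsQ hA hsA hξ => ?_⟩
  -- Coefficients on `A` all come from the net of stage `s`, since they must be available as limit
  -- coefficients from then on.
  choose ρ hρ hρδ using fun i => hnet (if i ∈ A then s else i) (ξ i) (hξ i)
  have hρA : ∀ i ∈ A, ρ i ∈ Λ s := fun i hi => by simpa [hi] using hρ i
  have hρΛ : ∀ i, ρ i ∈ Λ i := fun i => by
    by_cases hi : i ∈ A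
    · exact hΛ (hsA i hi) (hρA i hi)
    · simpa [hi] using hρ i
  have herr : ∀ i, ‖ξ i - ρ i‖ ≤ ε i + if i ∈ A then 1 / (1 + (h s : ℝ)) else 0 := by
    intro i
    refine (hρδ i).trans ?_
    split_ifs with hi
    · exact (min_le_right _ _).trans (by linarith [hε i])
    · exact (min_le_left _ _).trans (by simp)
  have hsum : ∑ i ∈ Finset.range Q, ‖ξ i - ρ i‖ ≤ 3 := by
    refine (Finset.sum_le_sum fun i _ => herr i).trans ?_
    rw [Finset.sum_add_distrib, ← Finset.sum_filter, Finset.sum_const, nsmul_eq_mul]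
    have h1 : ((Finset.range Q).filter (· ∈ A)).card ≤ h s :=
      (Finset.card_le_card fun i hi => (Finset.mem_filter.1 hi).2).trans hA
    have h2 : ((((Finset.range Q).filter (· ∈ A)).card : ℕ) : ℝ) * (1 / (1 + (h s : ℝ))) ≤ 1 := by
      rw [mul_one_div, div_le_one (by positivity)]
      have : ((((Finset.range Q).filter (· ∈ A)).card : ℕ) : ℝ) ≤ h s := by exact_mod_cast h1
      linarith
    linarith [hεsum Q]
  have hdiff : ∀ B ⊆ Finset.range Q,
      ‖∑ i ∈ B, ξ i • v (l i) - ∑ i ∈ B, ρ i • v (l i)‖ ≤ 3 * c := by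
    intro B hB
    rw [← Finset.sum_sub_distrib]
    calc ‖∑ i ∈ B, (ξ i • v (l i) - ρ i • v (l i))‖
        ≤ ∑ i ∈ B, ‖ξ i - ρ i‖ * c := norm_sum_le_of_le _ fun i _ => by
          rw [← sub_smul, norm_smul]
          gcongr
          exact hv _
      _ ≤ ∑ i ∈ Finset.range Q, ‖ξ i - ρ i‖ * c :=
          Finset.sum_le_sum_of_subset_of_nonneg hB fun i _ _ => by positivity
      _ ≤ 3 * c := by rw [← Finset.sum_mul]; gcongr
  have h1 := H s A ρ Q hsQ hA hρA hρΛ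
  have h2 := hdiff _ (Finset.filter_subset (fun i => i < s ∨ i ∈ A) (Finset.range Q))
  have h3 := hdiff _ (Finset.Subset.refl (Finset.range Q))
  have h4 := norm_le_norm_add_norm_sub' (∑ i ∈ Finset.range Q with i < s ∨ i ∈ A, ξ i • v (l i))
    (∑ i ∈ Finset.range Q with i < s ∨ i ∈ A, ρ i • v (l i))
  have h5 := norm_le_norm_add_norm_sub (∑ i ∈ Finset.range Q, ξ i • v (l i))
    (∑ i ∈ Finset.range Q, ρ i • v (l i))
  linarith [hεsum Q]

/-- The projections onto `[0, s) ∪ A` with `A` beyond `s` and `A.card ≤ h s` are uniformly bounded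
on the closed span of a suitable subsequence, if there are bounded biorthogonal functionals. -/
theorem exists_subseq_norm_coordProj_le {g : ℕ → StrongDual 𝕜 X} (hv : ∀ i, ‖v i‖ ≤ c)
    (hg : ∀ i, ‖g i‖ ≤ c) (hgv : ∀ k i, g k (v i) = if k = i then 1 else 0)
    (hw : IsWeaklyNull 𝕜 v) (h : ℕ → ℕ) (hh : Monotone h) :
    ∃ l : ℕ → ℕ, StrictMono l ∧ ∀ (s : ℕ) (A : Finset ℕ),
      A.card ≤ h s → (∀ i ∈ A, s ≤ i) → ∀ x ∈ closedSpan 𝕜 (v ∘ l),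
      ‖coordProj (v ∘ l) (g ∘ l) (Finset.range s ∪ A) x‖ ≤ (6 * c + 5) * ‖x‖ := by
  classical
  obtain ⟨l, hl, H⟩ := exists_subseq_norm_sum_filter_le_of_norm_le hv hw h hh c
  refine ⟨l, hl, fun s A hA hsA x hx => ?_⟩
  have hclosed : IsClosed
      {x | ‖coordProj (v ∘ l) (g ∘ l) (Finset.range s ∪ A) x‖ ≤ (6 * c + 5) * ‖x‖} := by
    refine isClosed_le (Continuous.norm ?_) (by fun_prop)
    unfold coordProj
    fun_prop
  refine closure_minimal (fun x hx => ?_) hclosed hx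
  obtain ⟨ζ, rfl⟩ := (Finsupp.mem_span_range_iff_exists_finsupp).1 hx
  set x : X := ζ.sum fun i a => a • (v ∘ l) i with hxdef
  have hcoef : ∀ i, g (l i) x = ζ i := by
    intro i
    simp only [hxdef, Finsupp.sum, map_sum, map_smul, Function.comp, hgv, hl.injective.eq_iff]
    simp
    exact Eq.symm
  rcases eq_or_ne x 0 with h0 | h0
  · change ‖coordProj _ _ _ x‖ ≤ _ * ‖x‖
    rw [h0]
    simp [coordProj]
  have hx0 : 0 < ‖x‖ := norm_pos_iff.2 h0
  obtain ⟨Q, hQ⟩ : ∃ Q, Finset.range s ∪ A ∪ ζ.support ⊆ Finset.range Q :=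
    ⟨_, Finset.subset_range_sup_succ _⟩
  have hsQ : s ≤ Q := Finset.range_subset_range.1
    ((Finset.subset_union_left.trans Finset.subset_union_left).trans hQ)
  -- Normalizing `x` bounds the coefficients by `c` and turns the additive error `6 * c + 4` into a
  -- multiplicative one.
  let ξ : ℕ → 𝕜 := fun i => ((‖x‖⁻¹ : ℝ) : 𝕜) * ζ i
  have hξ : ∀ i, ‖ξ i‖ ≤ c := by
    intro i
    have : ‖ζ i‖ ≤ c * ‖x‖ := by
      rw [← hcoef]
      exact (g (l i)).le_of_opNorm_le (hg _) x
    simp only [ξ, norm_mul, RCLike.norm_ofReal, abs_inv, abs_norm]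
    rw [inv_mul_le_iff₀ hx0]
    linarith
  have hxsum : ∑ i ∈ Finset.range Q, ζ i • v (l i) = x := by
    rw [hxdef, Finsupp.sum]
    refine (Finset.sum_subset (Finset.subset_union_right.trans hQ) fun i _ hi => ?_).symm
    simp [Finsupp.notMem_support_iff.1 hi]
  have hF : (Finset.range Q).filter (fun i => i < s ∨ i ∈ A) = Finset.range s ∪ A := by
    ext i
    simp only [Finset.mem_filter, Finset.mem_union, Finset.mem_range, and_iff_right_iff_imp]
    intro hi
    simpa using hQ (Finset.mem_union_left _ (by simpa using hi))
  have key := H s A ξ Q hsQ hA hsA hξ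
  rw [hF] at key
  simp only [ξ, mul_smul, ← Finset.smul_sum, norm_smul, hxsum, RCLike.norm_ofReal, abs_inv,
    abs_norm, inv_mul_cancel₀ hx0.ne'] at key
  rw [inv_mul_le_iff₀ hx0] at key
  have : coordProj (v ∘ l) (g ∘ l) (Finset.range s ∪ A) x =
      ∑ i ∈ Finset.range s ∪ A, ζ i • v (l i) :=
    Finset.sum_congr rfl fun i _ => by simp [hcoef]
  change ‖coordProj _ _ _ x‖ ≤ _ * ‖x‖
  rw [this]
  linarith

end

/-! ### Two criteria for a quasi-greedy subsequence -/

noncomputable section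

variable {𝕜 X : Type*} [RCLike 𝕜] [NormedAddCommGroup X] [NormedSpace 𝕜 X]
  {e : ℕ → X} {f : ℕ → StrongDual 𝕜 X}

theorem eq_zero_of_mem_closedSpan {u : ℕ → X} {φ : StrongDual 𝕜 X} (hφ : ∀ k, φ (u k) = 0)
    {x : X} (hx : x ∈ closedSpan 𝕜 u) : φ x = 0 := by
  have hle : closedSpan 𝕜 u ≤ LinearMap.ker (φ : X →ₗ[𝕜] 𝕜) := by
    refine Submodule.topologicalClosure_minimal _ ?_ φ.isClosed_ker
    rw [Submodule.span_le]
    rintro _ ⟨k, rfl⟩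
    exact hφ k
  exact hle hx

theorem IsSeminormalizedMBasis.apply_eq_zero (hB : IsSeminormalizedMBasis 𝕜 e f) {i : ℕ → ℕ}
    {j : ℕ} (hj : j ∉ Set.range i) {x : X} (hx : x ∈ closedSpan 𝕜 (e ∘ i)) : f j x = 0 :=
  eq_zero_of_mem_closedSpan (fun k => by
    rw [Function.comp, hB.biorthogonal, if_neg fun h => hj ⟨k, h.symm⟩]) hx

theorem dense_span_toClosedSpan (u : ℕ → X) :
    (Submodule.span 𝕜 (Set.range (toClosedSpan 𝕜 u))).topologicalClosure = ⊤ := by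
  rw [eq_top_iff]
  rintro ⟨x, hx⟩ -
  rw [← SetLike.mem_coe, Submodule.topologicalClosure_coe, closure_subtype]
  have : (Subtype.val '' (Submodule.span 𝕜 (Set.range (toClosedSpan 𝕜 u)) :
      Set (closedSpan 𝕜 u))) = (Submodule.span 𝕜 (Set.range u) : Set X) := by
    have h := Submodule.map_span (closedSpan 𝕜 u).subtype (Set.range (toClosedSpan 𝕜 u))
    rw [← Set.range_comp] at h
    exact congrArg (fun S : Submodule 𝕜 X => (S : Set X)) h
  rw [this]
  exact hx

/-- A subsequence of a semi-normalized Markushevich basis is a quasi-greedy sequence as soon as its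
greedy sums, with respect to the restricted functionals, are uniformly bounded. -/
theorem IsSeminormalizedMBasis.isQuasiGreedySequence_comp (hB : IsSeminormalizedMBasis 𝕜 e f)
    {i : ℕ → ℕ} (hi : StrictMono i) {K : ℝ} (hK : 0 < K)
    (h : ∀ x ∈ closedSpan 𝕜 (e ∘ i), ∀ A : Finset ℕ, A.Nonempty → IsGreedySet (f ∘ i) x A →
      ‖coordProj (e ∘ i) (f ∘ i) A x‖ ≤ K * ‖x‖) :
    IsQuasiGreedySequence 𝕜 (e ∘ i) := by
  refine ⟨fun k => (f (i k)).comp (closedSpan 𝕜 (e ∘ i)).subtypeL,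
    ⟨dense_span_toClosedSpan _, fun k j => ?_, fun x hx => ?_, ?_⟩, K, hK, fun x A hA hgr => ?_⟩
  · simpa [toClosedSpan, hi.injective.eq_iff] using hB.biorthogonal (i k) (i j)
  · refine Subtype.ext (hB.total _ fun j => ?_)
    by_cases hj : j ∈ Set.range i
    · obtain ⟨k, rfl⟩ := hj
      exact hx k
    · exact hB.apply_eq_zero hj x.2
  · obtain ⟨c, hc, hbd⟩ := hB.bounded
    refine ⟨c, hc, fun k => ⟨(hbd (i k)).1, ?_⟩⟩
    refine ContinuousLinearMap.opNorm_le_bound _ hc.le fun x => ?_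
    exact (f (i k)).le_of_opNorm_le (hbd (i k)).2 x
  · have := h x x.2 A (Finset.card_pos.1 hA) hgr
    convert! this using 1
    rw [← Submodule.norm_coe]
    simp [coordProj, toClosedSpan]

/-- If there are arbitrarily long vectors with coefficients of modulus at least one off the
subsequence whose norms are bounded, greedy sums along the subsequence can be
completed to greedy sums of admissible orders. -/
theorem IsSeminormalizedMBasis.isQuasiGreedySequence_of_padding
    (hB : IsSeminormalizedMBasis 𝕜 e f) {n : ℕ → ℕ} (hn : StrictMono n)
    (hqg : IsQuasiGreedyFor (Set.range n) e f) {i : ℕ → ℕ} (hi : StrictMono i) {C₀ : ℝ}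
    (hpad : ∀ N : ℕ, ∃ D : Finset ℕ, D.card = N ∧ (∀ j ∈ D, j ∉ Set.range i) ∧
      ∃ b : ℕ → 𝕜, (∀ j ∈ D, 1 ≤ ‖b j‖) ∧ ‖∑ j ∈ D, b j • e j‖ ≤ C₀) :
    IsQuasiGreedySequence 𝕜 (e ∘ i) := by
  classical
  obtain ⟨c, hc, hbd⟩ := hB.bounded
  obtain ⟨C, hC, hgreedy⟩ := hqg
  have hC₀ : 0 ≤ C₀ := by
    obtain ⟨D, -, -, b, -, hD⟩ := hpad 0
    exact (norm_nonneg _).trans hD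
  refine hB.isQuasiGreedySequence_comp hi (K := C * (1 + c * C₀) + c * C₀) (by positivity)
    fun x hx A hA hgr => ?_
  obtain ⟨k₀, hk₀, hmin⟩ := A.exists_min_image (fun k => ‖f (i k) x‖) hA
  set t : ℝ := ‖f (i k₀) x‖ with ht
  have htx : t ≤ c * ‖x‖ := (f (i k₀)).le_of_opNorm_le (hbd _).2 x
  -- Since `m ≤ n m`, this many extra indices raise the order to exactly `n A.card`.
  obtain ⟨D, hDcard, hDi, b, hb, hD⟩ := hpad (n A.card - A.card)
  have hzero : ∀ j ∈ D, f j x = 0 := fun j hj => hB.apply_eq_zero (hDi j hj) hx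
  set A' : Finset ℕ := A.map ⟨i, hi.injective⟩ with hA'
  have hdisj : Disjoint A' D := by
    rw [Finset.disjoint_left]
    intro j hj hjD
    obtain ⟨k, -, rfl⟩ := Finset.mem_map.1 hj
    exact hDi _ hjD ⟨k, rfl⟩
  set w : X := ∑ j ∈ D, b j • e j with hw
  set z : X := x + (t : 𝕜) • w with hz
  have hfz : ∀ j, f j z = f j x + if j ∈ D then (t : 𝕜) * b j else 0 := by
    intro j
    simp [hz, hw, hB.biorthogonal]
  have hfzA : ∀ j ∉ D, f j z = f j x := fun j hj => by simp [hfz, hj]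
  have hfzD : ∀ j ∈ D, f j z = (t : 𝕜) * b j := fun j hj => by simp [hfz, hj, hzero]
  have hgrz : IsGreedySet f z (A' ∪ D) := by
    intro p hp j hj
    rw [Finset.mem_union, not_or] at hj
    have hjt : ‖f j z‖ ≤ t := by
      rw [hfzA j hj.2]
      by_cases hji : j ∈ Set.range i
      · obtain ⟨k, rfl⟩ := hji
        exact hgr k₀ hk₀ k fun hk => hj.1 (Finset.mem_map.2 ⟨k, hk, rfl⟩)
      · rw [hB.apply_eq_zero hji hx, norm_zero]
        exact norm_nonneg _
    refine hjt.trans ?_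
    by_cases hpD : p ∈ D
    · rw [hfzD p hpD, norm_mul, RCLike.norm_ofReal, abs_of_nonneg (norm_nonneg _)]
      exact le_mul_of_one_le_right (norm_nonneg _) (hb p hpD)
    · obtain ⟨k, hk, rfl⟩ := Finset.mem_map.1 ((Finset.mem_union.1 hp).resolve_right hpD)
      rw [hfzA _ hpD]
      exact hmin k hk
  have hcard : (A' ∪ D).card ∈ Set.range n := by
    refine ⟨A.card, ?_⟩
    have := hn.le_apply (x := A.card)
    rw [Finset.card_union_of_disjoint hdisj, hDcard, hA', Finset.card_map]
    omega
  have hproj : coordProj e f (A' ∪ D) z = coordProj (e ∘ i) (f ∘ i) A x + (t : 𝕜) • w := by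
    rw [coordProj, Finset.sum_union hdisj]
    congr 1
    · rw [hA', Finset.sum_map]
      refine Finset.sum_congr rfl fun k hk => ?_
      have : i k ∉ D := fun h => hDi _ h ⟨k, rfl⟩
      simp [hfzA _ this]
    · rw [hw, Finset.smul_sum]
      exact Finset.sum_congr rfl fun j hj => by rw [hfzD j hj, mul_smul]
  have hnw : ‖(t : 𝕜) • w‖ ≤ c * C₀ * ‖x‖ := by
    rw [norm_smul, RCLike.norm_ofReal, abs_of_nonneg (norm_nonneg _)]
    calc t * ‖w‖ ≤ (c * ‖x‖) * C₀ := by gcongr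
      _ = c * C₀ * ‖x‖ := by ring
  have key := hgreedy z _ hcard hgrz
  rw [hproj] at key
  have h1 : ‖z‖ ≤ ‖x‖ + c * C₀ * ‖x‖ := (norm_add_le _ _).trans (by linarith)
  have h2 := norm_le_add_norm_add (coordProj (e ∘ i) (f ∘ i) A x) ((t : 𝕜) • w)
  have h3 : C * ‖z‖ ≤ C * (‖x‖ + c * C₀ * ‖x‖) := by gcongr
  calc _ ≤ C * (‖x‖ + c * C₀ * ‖x‖) + c * C₀ * ‖x‖ := by linarith
    _ = _ := by ring

/-- If long vectors with coefficients of modulus at least one have large norms, then, along a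
subsequence with bounded Schreier-type projections, greedy sums are uniformly bounded. -/
theorem norm_coordProj_le_of_isGreedySet {u : ℕ → X} {g : ℕ → StrongDual 𝕜 X} {c K : ℝ}
    (hu : ∀ k, ‖u k‖ ≤ c) (hK : 0 < K) {N h : ℕ → ℕ} (hNh : ∀ s, N s ≤ h s)
    (hN : ∀ (s : ℕ) (D : Finset ℕ), D.card = N s → ∀ b : ℕ → 𝕜, (∀ k ∈ D, 1 ≤ ‖b k‖) →
      2 * K * (s + 1) < ‖∑ k ∈ D, b k • u k‖)
    {x : X} (hP : ∀ (s : ℕ) (A : Finset ℕ), A.card ≤ h s → (∀ k ∈ A, s ≤ k) →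
      ‖coordProj u g (Finset.range s ∪ A) x‖ ≤ K * ‖x‖)
    {A : Finset ℕ} (hA : A.Nonempty) (hgr : IsGreedySet g x A) :
    ‖coordProj u g A x‖ ≤ (K + c) * ‖x‖ := by
  classical
  obtain ⟨k₀, hk₀, hmin⟩ := A.exists_min_image (fun k => ‖g k x‖) hA
  set t : ℝ := ‖g k₀ x‖ with ht
  have hc : 0 ≤ c := (norm_nonneg _).trans (hu 0)
  -- Take `⌊‖x‖ / t⌋`; if `t = 0`, any `s` beyond `A` serves and the tail of `A` is empty.
  obtain ⟨s, hs, hs'⟩ : ∃ s : ℕ, s * t ≤ ‖x‖ ∧ ((0 < t ∧ ‖x‖ < (s + 1) * t) ∨ ∀ k ∈ A, k < s) := by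
    rcases (norm_nonneg (g k₀ x)).eq_or_lt with h0 | h0
    · obtain ⟨s, hs⟩ := A.exists_nat_subset_range
      refine ⟨s, ?_, Or.inr fun k hk => Finset.mem_range.1 (hs hk)⟩
      rw [ht, ← h0]
      simp
    · refine ⟨⌊‖x‖ / t⌋₊, ?_, Or.inl ⟨h0, ?_⟩⟩
      · exact (le_div_iff₀ h0).1 (Nat.floor_le (by positivity))
      · exact (div_lt_iff₀ h0).1 (Nat.lt_floor_add_one _)
  set B : Finset ℕ := A.filter (s ≤ ·) with hB
  have hBs : ∀ k ∈ B, s ≤ k := fun k hk => (Finset.mem_filter.1 hk).2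
  have hcard : B.card ≤ h s := by
    rcases hs' with ⟨htpos, hs'⟩ | hs'
    -- Otherwise `N s` of these indices form `D`: subtracting two projections gives norm at most `2
    -- * K * ‖x‖` on `D`, while the coefficients, all at least `t`, force more than `2 * K * (s + 1)
    -- * t`.
    · by_contra! hlt
      obtain ⟨D, hDB, hD⟩ := Finset.exists_subset_card_eq ((hNh s).trans hlt.le)
      have hsplit : coordProj u g (Finset.range s ∪ D) x =
          coordProj u g (Finset.range s ∪ ∅) x + coordProj u g D x := by
        rw [Finset.union_empty]
        refine Finset.sum_union (Finset.disjoint_left.2 fun k hk hkD => ?_)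
        exact absurd (Finset.mem_range.1 hk) (not_lt.2 (hBs k (hDB hkD)))
      have h1 := hP s D (hD ▸ hNh s) fun k hk => hBs k (hDB hk)
      have h2 := hP s ∅ (by simp) (by simp)
      have h3 := hN s D hD (fun k => (t⁻¹ : ℝ) * g k x) fun k hk => by
        rw [norm_mul, RCLike.norm_ofReal, abs_inv, abs_of_pos htpos, le_inv_mul_iff₀ htpos,
          mul_one]
        exact hmin k (Finset.mem_filter.1 (hDB hk)).1
      have h4 : ∑ k ∈ D, (((t⁻¹ : ℝ) : 𝕜) * g k x) • u k =
          ((t⁻¹ : ℝ) : 𝕜) • coordProj u g D x := by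
        simp only [coordProj, Finset.smul_sum, mul_smul]
      rw [h4, norm_smul, RCLike.norm_ofReal, abs_inv, abs_of_pos htpos,
        lt_inv_mul_iff₀ htpos] at h3
      rw [hsplit] at h1
      have h5 := norm_le_add_norm_add (coordProj u g D x) (coordProj u g (Finset.range s ∪ ∅) x)
      rw [add_comm (coordProj u g D x)] at h5
      have h6 : 2 * K * ‖x‖ ≤ 2 * K * ((s + 1) * t) := by gcongr
      linarith
    · rw [hB, Finset.filter_false_of_mem fun k hk => not_le.2 (hs' k hk)]
      simp
  have hdecomp : coordProj u g (Finset.range s ∪ B) x =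
      coordProj u g A x + coordProj u g (Finset.range s \ A) x := by
    rw [coordProj, coordProj, coordProj, ← Finset.sum_union Finset.disjoint_sdiff]
    congr 1
    ext k
    simp only [hB, Finset.mem_union, Finset.mem_range, Finset.mem_filter, Finset.mem_sdiff]
    rcases lt_or_ge k s with hk | hk <;> simp [hk] <;> tauto
  have h1 := hP s B hcard hBs
  have h2 : ‖coordProj u g (Finset.range s \ A) x‖ ≤ c * ‖x‖ := by
    calc ‖coordProj u g (Finset.range s \ A) x‖
        ≤ ∑ k ∈ Finset.range s \ A, t * c := norm_sum_le_of_le _ fun k hk => by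
          rw [norm_smul]
          gcongr
          · exact hgr k₀ hk₀ k (Finset.mem_sdiff.1 hk).2
          · exact hu k
      _ ≤ s * (t * c) := by
          rw [Finset.sum_const, nsmul_eq_mul]
          gcongr
          simpa using Finset.card_le_card (Finset.sdiff_subset (s := Finset.range s) (t := A))
      _ = c * (s * t) := by ring
      _ ≤ c * ‖x‖ := by gcongr
  rw [hdecomp] at h1
  have h3 := norm_le_add_norm_add (coordProj u g A x) (coordProj u g (Finset.range s \ A) x)
  linarith

end

/-! ### The dichotomy -/

theorem corollary6p2 {𝕜 : Type*} [RCLike 𝕜] {X : Type*} [NormedAddCommGroup X]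
    [NormedSpace 𝕜 X] [CompleteSpace X]
    (e : ℕ → X) (f : ℕ → StrongDual 𝕜 X) (hB : IsSeminormalizedMBasis 𝕜 e f)
    (n : ℕ → ℕ) (hn : StrictMono n) (hn_pos : ∀ k, 1 ≤ n k)
    (hqg : IsQuasiGreedyFor (Set.range n) e f)
    (hweak : IsWeaklyNull 𝕜 e) :
    ∃ i : ℕ → ℕ, StrictMono i ∧ IsQuasiGreedySequence 𝕜 (fun k => e (i k)) := by
  classical
  have heven : StrictMono fun k : ℕ => 2 * k := fun a b h => by dsimp only; omega
  by_cases hcase : ∃ C₀ : ℝ, ∀ N : ℕ, ∃ D : Finset ℕ, D.card = N ∧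
      ∃ b : ℕ → 𝕜, (∀ k ∈ D, 1 ≤ ‖b k‖) ∧ ‖∑ k ∈ D, b k • e (2 * k)‖ ≤ C₀
  · obtain ⟨C₀, hC₀⟩ := hcase
    have hodd : StrictMono fun k : ℕ => 2 * k + 1 := fun a b h => by dsimp only; omega
    refine ⟨_, hodd, hB.isQuasiGreedySequence_of_padding hn hqg hodd (C₀ := C₀) fun N => ?_⟩
    obtain ⟨D, hD, b, hb, hbD⟩ := hC₀ N
    refine ⟨D.map ⟨_, heven.injective⟩, by simpa using hD, ?_, fun j => b (j / 2), ?_, ?_⟩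
    · simp only [Finset.mem_map, Function.Embedding.coeFn_mk, Set.mem_range]
      rintro _ ⟨k, -, rfl⟩ ⟨m, hm⟩
      omega
    · simpa using hb
    · simpa using hbD
  · push Not at hcase
    obtain ⟨c, hc, hbd⟩ := hB.bounded
    choose N hN using fun s : ℕ => hcase (2 * (6 * c + 5) * (s + 1))
    -- A monotone majorant of `N`.
    let h : ℕ → ℕ := fun s => ∑ i ∈ Finset.range (s + 1), N i
    have hh : Monotone h := fun a b hab =>
      Finset.sum_le_sum_of_subset (Finset.range_mono (by omega))
    obtain ⟨l, hl, H⟩ := exists_subseq_norm_coordProj_le (𝕜 := 𝕜) (v := fun k => e (2 * k))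
      (g := fun k => f (2 * k)) (c := c) (fun k => (hbd _).1) (fun k => (hbd _).2)
      (fun k i => by simp [hB.biorthogonal])
      (fun φ => (hweak φ).comp heven.tendsto_atTop) h hh
    refine ⟨_, heven.comp hl, hB.isQuasiGreedySequence_comp (heven.comp hl)
      (K := 6 * c + 5 + c) (by positivity) fun x hx A hA hgr => ?_⟩
    refine norm_coordProj_le_of_isGreedySet (c := c) (fun k => (hbd _).1) (by positivity)
      (N := N) (h := h) (fun s => Finset.single_le_sum (fun _ _ => Nat.zero_le _) (by simp))
      (fun s D hD b hb => ?_) (fun s A hA hsA => H s A hA hsA x hx) hA hgr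
    -- The lower estimate concerns all even indices, so it passes to the subsequence by transporting
    -- `D` and `b` along `l`.
    have := hN s (D.map ⟨l, hl.injective⟩) (by simpa using hD) (b ∘ Function.invFun l)
      (by simpa [Function.leftInverse_invFun hl.injective _] using hb)
    simpa [Function.leftInverse_invFun hl.injective _] using this
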